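/- Let $f(x,y)=x^3(y^2+y+1)-y(y^2-2y+4)\in\mathbb{Z}[x,y]$. Put $R^{(1)}(x,x_1)=f(x,x_1)$ and, inductively for $n\ge 2$, $$R^{(n)}(x,x_n)=\operatorname{Res}_{x_{n-1}}\bigl(R^{(n-1)}(x,x_{n-1}),\,f(x_{n-1},x_n)\bigr),$$ and let $R_n(x)=R^{(n)}(x,x)\in\mathbb{Z}[x]$ for $n\ge 1$. Then for every $n\ge 1$: (a) the polynomial $R_n(x)$ is nonzero and has distinct roots (in $\mathbb{C}$); (b) the expression $$P_n(x)=\prod_{k\mid n}R_k(x)^{\mu(n/k)},$$ a priori an element of the field of fractions of $\mathbb{Z}[x]$, is a nonzero polynomial in $\mathbb{Z}[x]$ with distinct roots (in $\mathbb{C}$), and for $n\ge 2$ its degree is $$\deg P_n(x)=2\sum_{k\mid n}\mu(n/k)\,3^k;$$ (c) $R_n(x)\equiv(-1)^{n-1}(x^{3^n}-x)(x-1)^{3^n-1}\pmod 3$; (d) $\deg R_n(x)=2\cdot 3^n-1$. -/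

import Mathlib

open Polynomial

noncomputable section

/-- The value `f(a, b) = a³(b² + b + 1) - b(b² - 2b + 4)` in a commutative ring. -/
def fPoly {A : Type*} [CommRing A] (a b : A) : A :=
  a ^ 3 * (b ^ 2 + b + 1) - b * (b ^ 2 - 2 * b + 4)

/-- The iterated resultants `R⁽ⁿ⁾(x, y)`, `n ≥ 1`, as elements of `ℤ[x][y]`: the inner variable is
`x` and the outer variable is `y`. The resultant with respect to the intermediate variable `t` is
computed in `ℤ[x][y][t]`: there `x` is `C (C X)`, `y` is `C X` and `t` is `X`, so that
`(iterRes (n + 1)).map C` is `R⁽ⁿ⁺¹⁾(x, t)` and `fPoly X (C X)` is `f(t, y)`.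
The value at `0` is a placeholder. -/
def iterRes : ℕ → ℤ[X][X]
  | 0 => 0
  | 1 => fPoly (C X) X
  | n + 2 => resultant ((iterRes (n + 1)).map (C : ℤ[X] →+* ℤ[X][X]))
      (fPoly X (C X) : ℤ[X][X][X])

/-- `R_n(x) = R⁽ⁿ⁾(x, x)`. -/
def Rpoly (n : ℕ) : ℤ[X] := (iterRes n).eval X

/-- The expression `P_n(x) = ∏_{k ∣ n} R_k(x) ^ μ(n / k)`, an element of the field of fractions
of `ℤ[x]`. -/
def Pfrac (n : ℕ) : FractionRing ℤ[X] :=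
  ∏ k ∈ n.divisors,
    (algebraMap ℤ[X] (FractionRing ℤ[X]) (Rpoly k)) ^ (ArithmeticFunction.moebius (n / k))

/-- A nonzero integer polynomial all of whose complex roots are simple. -/
def HasDistinctRoots (p : ℤ[X]) : Prop :=
  p ≠ 0 ∧ (p.aroots ℂ).Nodup

end

/-!
The equation `f(a, b) = 0` is a correspondence, and the roots of `R_n` are the points that it can
carry back to themselves in `n` steps. Swapping `x` and `1 / x` turns `f(x, y)` into a polynomial
whose behaviour at infinity is explicit; this gives the degree of `R_n` and shows that its leading
coefficient is a unit, so that all its roots are algebraic integers.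

Modulo `3` one has `f(x, y) = (x ^ 3 - y) (y - 1) ^ 2`: apart from the point `1`, the correspondence
is Frobenius. Hence above each `b ≠ 1` with `b ^ 3 ^ n = b` lies exactly one root of `R_n`. The
involution `(a - 1) (a' - 1) = 3` reverses the correspondence and maps these `3 ^ n - 1` roots to
others with residue `1`. Together with the root `1` they exhaust the degree, so all roots are
simple. The same reduction shows that the `n` with `R_n(a) = 0` are the multiples of a period `d`,
so by Möbius inversion the order of vanishing of `P_n` at `a` is `1` if `n = d` and `0` otherwise.
-/

theorem exists_injective_ringHom_isAlgClosed.{u} (A : Type u) [CommRing A] [IsDomain A] :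
    ∃ (K : Type u) (_ : Field K) (_ : IsAlgClosed K) (φ : A →+* K), Function.Injective φ :=
  ⟨AlgebraicClosure (FractionRing A), inferInstance, inferInstance,
    (algebraMap (FractionRing A) _).comp (algebraMap A _),
    (algebraMap (FractionRing A) _).injective.comp (IsFractionRing.injective A _)⟩

section Correspondence

variable {A B : Type*} [CommRing A] [CommRing B]

theorem map_fPoly (φ : A →+* B) (a b : A) : φ (fPoly a b) = fPoly (φ a) (φ b) := by
  simp only [fPoly, map_sub, map_add, map_mul, map_pow, map_one, map_ofNat]

theorem fPoly_C_X (a : A) :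
    fPoly (C a) X = C (-1) * X ^ 3 + C (a ^ 3 + 2) * X ^ 2 + C (a ^ 3 - 4) * X + C (a ^ 3) := by
  simp only [fPoly, map_sub, map_add, map_pow, map_neg, map_one, map_ofNat]
  ring

theorem natDegree_fPoly_C_X [Nontrivial A] (a : A) : (fPoly (C a) X).natDegree = 3 := by
  rw [fPoly_C_X]
  exact natDegree_cubic (neg_ne_zero.2 one_ne_zero)

theorem leadingCoeff_fPoly_C_X [Nontrivial A] (a : A) :
    (fPoly (C a) X).leadingCoeff = -1 := by
  rw [fPoly_C_X]
  exact leadingCoeff_cubic (neg_ne_zero.2 one_ne_zero)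

theorem fPoly_X_C (b : A) :
    fPoly X (C b) =
      C (b ^ 2 + b + 1) * X ^ 3 + C 0 * X ^ 2 + C 0 * X + C (-(b * (b ^ 2 - 2 * b + 4))) := by
  simp only [fPoly, map_sub, map_add, map_mul, map_pow, map_neg, map_one, map_ofNat, map_zero]
  ring

theorem natDegree_fPoly_X_C_le (b : A) : (fPoly X (C b)).natDegree ≤ 3 :=
  fPoly_X_C b ▸ natDegree_cubic_le

theorem coeff_three_fPoly_X_C (b : A) : (fPoly X (C b)).coeff 3 = b ^ 2 + b + 1 := by
  rw [fPoly_X_C]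
  simp only [coeff_add, coeff_C_mul, coeff_X_pow, coeff_X, coeff_C]
  norm_num

theorem natDegree_fPoly_X_C_X [Nontrivial A] : (fPoly X (C X) : A[X][X]).natDegree = 3 := by
  have hmonic : (X ^ 2 + X + 1 : A[X]).Monic := by monicity!
  rw [fPoly_X_C]
  exact natDegree_cubic hmonic.ne_zero

theorem eval_fPoly_X_C (a b : A) : (fPoly X (C b)).eval a = fPoly a b := by
  simpa using map_fPoly (evalRingHom a) X (C b)

end Correspondence

section ImagePoly

variable {A B : Type*} [CommRing A] [CommRing B]

/-- The image of a polynomial of formal degree `m` under the correspondence `fPoly`: as divisors on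
the projective line, the roots of `imagePoly m F` are the `b` with `fPoly a b = 0` for a root `a` of
`F`, where `F` has `m - F.natDegree` of its roots at infinity. -/
noncomputable def imagePoly (m : ℕ) (F : A[X]) : A[X] :=
  resultant (F.map C) (fPoly X (C X)) m 3

theorem map_imagePoly (φ : A →+* B) (m : ℕ) (F : A[X]) :
    (imagePoly m F).map φ = imagePoly m (F.map φ) := by
  rw [imagePoly, imagePoly, ← coe_mapRingHom, ← resultant_map_map, Polynomial.map_map,
    mapRingHom_comp_C, ← coe_mapRingHom (mapRingHom φ), map_fPoly, coe_mapRingHom φ,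
    Polynomial.map_map]
  rw [coe_mapRingHom, map_X, map_C, coe_mapRingHom, map_X]

theorem imagePoly_C_mul (m : ℕ) (c : A) (F : A[X]) :
    imagePoly m (C c * F) = C (c ^ 3) * imagePoly m F := by
  rw [imagePoly, Polynomial.map_mul, map_C, resultant_C_mul_left, ← C_pow, imagePoly]

theorem imagePoly_succ {m : ℕ} {F : A[X]} (hF : F.natDegree ≤ m) :
    imagePoly (m + 1) F = -(X ^ 2 + X + 1) * imagePoly m F := by
  rw [imagePoly, resultant_succ_left_deg _ _ _ _ (natDegree_map_le.trans hF),
    coeff_three_fPoly_X_C, imagePoly]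
  ring

theorem imagePoly_prod_X_sub_C [Nontrivial A] (T : Multiset A) :
    imagePoly T.card (T.map fun s => X - C s).prod = (T.map fun s => fPoly (C s) X).prod := by
  induction T using Multiset.induction_on with
  | empty => simp [imagePoly]
  | cons a T ih =>
    have hdeg : ((T.map fun s => X - C s).prod.map (C : A →+* A[X])).natDegree = T.card := by
      rw [natDegree_map_eq_of_injective C_injective, natDegree_multiset_prod_X_sub_C_eq_card]
    have hlin : (X - C (C a) : A[X][X]).natDegree = 1 := natDegree_X_sub_C _
    have hmul := resultant_mul_left (X - C (C a)) ((T.map fun s => X - C s).prod.map C)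
      (fPoly X (C X)) 3 (natDegree_fPoly_X_C_le X)
    rw [hdeg, hlin, resultant_X_sub_C_left _ _ _ (natDegree_fPoly_X_C_le X), eval_fPoly_X_C] at hmul
    rw [Multiset.map_cons, Multiset.prod_cons, Multiset.card_cons, Multiset.map_cons,
      Multiset.prod_cons, ← ih, add_comm, imagePoly, Polynomial.map_mul, Polynomial.map_sub, map_X,
      map_C, hmul, imagePoly]

theorem imagePoly_of_splits {K : Type*} [Field K] {F : K[X]} (hF : F.Splits) :
    imagePoly F.natDegree F =
      C (F.leadingCoeff ^ 3) * (F.roots.map fun s => fPoly (C s) X).prod := by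
  rw [hF.natDegree_eq_card_roots, ← imagePoly_prod_X_sub_C, ← imagePoly_C_mul, ← hF.eq_prod_roots]

theorem natDegree_leadingCoeff_imagePoly_of_splits {K : Type*} [Field K] {F : K[X]}
    (hF : F.Splits) (h0 : F ≠ 0) :
    (imagePoly F.natDegree F).natDegree = 3 * F.natDegree ∧
      (imagePoly F.natDegree F).leadingCoeff = F.leadingCoeff ^ 3 * (-1) ^ F.natDegree := by
  have hfactor : (0 : K[X]) ∉ F.roots.map fun s => fPoly (C s) X := by
    intro h
    obtain ⟨s, -, hs⟩ := Multiset.mem_map.1 h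
    simpa [hs] using natDegree_fPoly_C_X s
  rw [imagePoly_of_splits hF]
  constructor
  · rw [natDegree_C_mul (pow_ne_zero 3 (leadingCoeff_ne_zero.2 h0)),
      natDegree_multiset_prod _ hfactor, Multiset.map_map, hF.natDegree_eq_card_roots]
    simp [natDegree_fPoly_C_X, mul_comm]
  · rw [leadingCoeff_mul, leadingCoeff_C, leadingCoeff_multiset_prod, Multiset.map_map,
      hF.natDegree_eq_card_roots]
    simp [leadingCoeff_fPoly_C_X]

theorem natDegree_leadingCoeff_imagePoly [IsDomain A] {F : A[X]} (h0 : F ≠ 0) :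
    (imagePoly F.natDegree F).natDegree = 3 * F.natDegree ∧
      (imagePoly F.natDegree F).leadingCoeff = F.leadingCoeff ^ 3 * (-1) ^ F.natDegree := by
  obtain ⟨K, _, _, φ, hφ⟩ := exists_injective_ringHom_isAlgClosed A
  have h := natDegree_leadingCoeff_imagePoly_of_splits (IsAlgClosed.splits (F.map φ))
    ((Polynomial.map_ne_zero_iff hφ).2 h0)
  rw [natDegree_map_eq_of_injective hφ, ← map_imagePoly, natDegree_map_eq_of_injective hφ,
    leadingCoeff_map_of_injective hφ, leadingCoeff_map_of_injective hφ] at h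
  exact ⟨h.1, hφ (by simpa using h.2)⟩

/-- The `n`-fold image of a polynomial of formal degree `1` under the correspondence `fPoly`, a
polynomial of formal degree `3 ^ n`. The starting point `a` is `X - C a`; infinity is `C c` with
`c ≠ 0`. -/
noncomputable def iterImagePoly (F : A[X]) : ℕ → A[X]
  | 0 => F
  | n + 1 => imagePoly (3 ^ n) (iterImagePoly F n)

theorem iterImagePoly_succ (F : A[X]) (n : ℕ) :
    iterImagePoly F (n + 1) = imagePoly (3 ^ n) (iterImagePoly F n) := rfl

theorem map_iterImagePoly (φ : A →+* B) (F : A[X]) (n : ℕ) :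
    (iterImagePoly F n).map φ = iterImagePoly (F.map φ) n := by
  induction n with
  | zero => rfl
  | succ n ih => rw [iterImagePoly_succ, map_imagePoly, ih, iterImagePoly_succ]

theorem iterImagePoly_C_mul (c : A) (F : A[X]) (n : ℕ) :
    iterImagePoly (C c * F) n = C (c ^ 3 ^ n) * iterImagePoly F n := by
  induction n with
  | zero => rw [pow_zero, pow_one, iterImagePoly, iterImagePoly]
  | succ n ih =>
    rw [iterImagePoly_succ, ih, imagePoly_C_mul, ← pow_mul, ← pow_succ, iterImagePoly_succ]

theorem iterImagePoly_X_sub_C_natDegree_leadingCoeff [IsDomain A] (a : A) (n : ℕ) :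
    (iterImagePoly (X - C a) n).natDegree = 3 ^ n ∧
      (iterImagePoly (X - C a) n).leadingCoeff = (-1) ^ n := by
  induction n with
  | zero => exact ⟨natDegree_X_sub_C a, (leadingCoeff_X_sub_C a).trans (pow_zero _).symm⟩
  | succ n ih =>
    obtain ⟨hdeg, hlead⟩ := ih
    have h0 : iterImagePoly (X - C a) n ≠ 0 :=
      leadingCoeff_ne_zero.1 (hlead ▸ pow_ne_zero n (neg_ne_zero.2 one_ne_zero))
    have h3 : Odd (3 ^ n) := Odd.pow (by decide)
    obtain ⟨hdeg', hlead'⟩ := natDegree_leadingCoeff_imagePoly h0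
    rw [hdeg] at hdeg' hlead'
    refine ⟨hdeg'.trans (pow_succ' 3 n).symm, hlead'.trans ?_⟩
    rw [hlead, h3.neg_one_pow, ← pow_mul, mul_comm n, pow_mul,
      (by decide : Odd 3).neg_one_pow, pow_succ]

theorem iterImagePoly_C_natDegree_leadingCoeff [IsDomain A] {c : A} (hc : IsUnit c) (n : ℕ) :
    (iterImagePoly (C c) n).natDegree = 3 ^ n - 1 ∧
      IsUnit (iterImagePoly (C c) n).leadingCoeff := by
  induction n with
  | zero => simpa [iterImagePoly] using hc
  | succ n ih =>
    obtain ⟨hdeg, hlead⟩ := ih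
    have h0 : iterImagePoly (C c) n ≠ 0 := leadingCoeff_ne_zero.1 hlead.ne_zero
    have hpow : 3 ^ n = (iterImagePoly (C c) n).natDegree + 1 := by
      rw [hdeg, Nat.sub_add_cancel (Nat.one_le_pow _ _ (by norm_num))]
    have hmonic : (X ^ 2 + X + 1 : A[X]).Monic := by monicity!
    have hquad : (X ^ 2 + X + 1 : A[X]).natDegree = 2 := by compute_degree!
    obtain ⟨hdeg', hlead'⟩ := natDegree_leadingCoeff_imagePoly h0
    have hunit := hlead' ▸ (hlead.pow 3).mul ((isUnit_one (M := A)).neg.pow _)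
    rw [iterImagePoly_succ, hpow, imagePoly_succ le_rfl]
    constructor
    · rw [natDegree_mul (neg_ne_zero.2 hmonic.ne_zero) (leadingCoeff_ne_zero.1 hunit.ne_zero),
        natDegree_neg, hquad, hdeg']
      omega
    · rw [leadingCoeff_mul, leadingCoeff_neg, hmonic.leadingCoeff]
      exact isUnit_one.neg.mul hunit

end ImagePoly

theorem imagePoly_one_X_sub_C {A : Type*} [CommRing A] (a : A) :
    imagePoly 1 (X - C a) = fPoly (C a) X := by
  rw [imagePoly, Polynomial.map_sub, map_X, map_C,
    resultant_X_sub_C_left _ _ _ (natDegree_fPoly_X_C_le X), eval_fPoly_X_C]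

theorem iterRes_eq_iterImagePoly {n : ℕ} (hn : n ≠ 0) :
    iterRes n = iterImagePoly (X - C X) n := by
  induction n, Nat.one_le_iff_ne_zero.2 hn using Nat.le_induction with
  | base => exact (imagePoly_one_X_sub_C X).symm
  | succ n hn ih =>
    obtain ⟨m, rfl⟩ := Nat.exists_eq_add_of_le' ‹1 ≤ n›
    rw [iterRes, natDegree_fPoly_X_C_X, natDegree_map_eq_of_injective C_injective,
      ih m.succ_ne_zero, (iterImagePoly_X_sub_C_natDegree_leadingCoeff X _).1]
    rfl

theorem Rpoly_eq_eval_iterImagePoly (n : ℕ) : Rpoly n = (iterImagePoly (X - C X) n).eval X := by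
  obtain rfl | hn := eq_or_ne n 0
  · simp [Rpoly, iterRes, iterImagePoly]
  · rw [Rpoly, iterRes_eq_iterImagePoly hn]

theorem map_Rpoly_eq_eval_iterImagePoly {A : Type*} [CommRing A] (φ : ℤ[X] →+* A) (n : ℕ) :
    φ (Rpoly n) = (iterImagePoly (X - C (φ X)) n).eval (φ X) := by
  rw [Rpoly_eq_eval_iterImagePoly, ← eval₂_hom, ← eval_map, map_iterImagePoly,
    Polynomial.map_sub, map_X, map_C]

section Degree

open scoped LaurentPolynomial
open LaurentPolynomial (T T_add T_pow T_zero coeff_toLaurent invert invert_apply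
  support_coeff_toLaurent)

theorem coeff_toLaurent_natCast {R : Type*} [Semiring R] (p : R[X]) (i : ℕ) :
    (toLaurent p).coeff (i : ℤ) = p.coeff i := by
  rw [coeff_toLaurent]
  exact Finsupp.mapDomain_apply Nat.castEmbedding.injective _ i

theorem coeff_toLaurent_of_neg {R : Type*} [Semiring R] (p : R[X]) {i : ℤ} (hi : i < 0) :
    (toLaurent p).coeff i = 0 := by
  rw [← Finsupp.notMem_support_iff, support_coeff_toLaurent, Finset.mem_map]
  rintro ⟨k, -, rfl⟩
  exact hi.not_ge (Int.natCast_nonneg k)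

theorem coeff_of_toLaurent_eq_T_mul_invert {R : Type*} [CommSemiring R] {p q : R[X]} {N : ℕ}
    (h : toLaurent q = T N * invert (toLaurent p)) :
    q.natDegree ≤ N ∧ q.coeff N = p.coeff 0 := by
  have hcoeff (i : ℕ) : q.coeff i = (toLaurent p).coeff (N - i) := by
    rw [← coeff_toLaurent_natCast, h, T, AddMonoidAlgebra.coeff_single_mul_apply, one_mul,
      invert_apply]
    congr 1
    ring
  constructor
  · refine natDegree_le_iff_coeff_eq_zero.2 fun i hi => ?_
    rw [hcoeff, coeff_toLaurent_of_neg p (by omega)]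
  · rw [hcoeff, sub_self, ← Nat.cast_zero, coeff_toLaurent_natCast]

theorem toLaurent_coeff_iterImagePoly (n j : ℕ) :
    toLaurent ((iterImagePoly (X - C X : ℤ[X][X]) n).coeff j) =
      T (3 ^ n : ℕ) * invert (toLaurent ((iterImagePoly (C X * X - 1 : ℤ[X][X]) n).coeff j)) := by
  let ψ : ℤ[X] →+* ℤ[T;T⁻¹] := (invert : ℤ[T;T⁻¹] ≃ₐ[ℤ] ℤ[T;T⁻¹]).toRingHom.comp toLaurent
  have hψ : ψ X = T (-1) := by simp [ψ]
  have hmap : (iterImagePoly (X - C X : ℤ[X][X]) n).map toLaurent =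
      C (T (3 ^ n : ℕ)) * (iterImagePoly (C X * X - 1 : ℤ[X][X]) n).map ψ := by
    have hstart : (X - C (T 1) : ℤ[T;T⁻¹][X]) = C (T 1) * (C (T (-1)) * X - 1) := by
      rw [mul_sub, ← mul_assoc, ← C_mul, ← T_add, add_neg_cancel, T_zero, C_1, one_mul, mul_one]
    rw [map_iterImagePoly, map_iterImagePoly, Polynomial.map_sub, map_X, map_C, toLaurent_X,
      hstart, iterImagePoly_C_mul, T_pow, mul_one, Polynomial.map_sub, Polynomial.map_mul, map_C,
      map_X, Polynomial.map_one, hψ]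
  simpa [ψ] using congrArg (fun F => F.coeff j) hmap

theorem coeff_iterImagePoly_X_sub_C_X (n j : ℕ) :
    ((iterImagePoly (X - C X : ℤ[X][X]) n).coeff j).natDegree ≤ 3 ^ n ∧
      ((iterImagePoly (X - C X : ℤ[X][X]) n).coeff j).coeff (3 ^ n) =
        (iterImagePoly (-1 : ℤ[X]) n).coeff j := by
  obtain ⟨hdeg, hcoeff⟩ := coeff_of_toLaurent_eq_T_mul_invert (toLaurent_coeff_iterImagePoly n j)
  refine ⟨hdeg, hcoeff.trans ?_⟩
  have hmap := map_iterImagePoly (evalRingHom 0) (C X * X - 1 : ℤ[X][X]) n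
  rw [coeff_zero_eq_eval_zero, ← coe_evalRingHom, ← coeff_map, hmap]
  simp

theorem natDegree_coeff_eval_X {R : Type*} [CommSemiring R] {G : R[X][X]} {N : ℕ}
    (hy : G.natDegree ≤ N) (hx : ∀ j, (G.coeff j).natDegree ≤ N)
    (hN : (G.coeff N).natDegree < N - 1) :
    (G.eval X).natDegree ≤ 2 * N - 1 ∧
      (G.eval X).coeff (2 * N - 1) = (G.coeff (N - 1)).coeff N := by
  have hsum : G.eval X = ∑ j ∈ Finset.range (N + 1), G.coeff j * X ^ j :=
    eval_eq_sum_range' (Nat.lt_succ_of_le hy) X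
  rw [hsum]
  constructor
  · refine natDegree_sum_le_of_forall_le _ _ fun j hj => natDegree_mul_le.trans ?_
    have hj' := Finset.mem_range.1 hj
    have hxj := hx j
    have hXj := natDegree_X_pow_le (R := R) j
    obtain rfl | hjN := eq_or_ne j N <;> omega
  · rw [finsetSum_coeff, Finset.sum_eq_single (N - 1)]
    · rw [coeff_mul_X_pow', if_pos (by omega)]
      congr 1
      omega
    · intro j hj hjN
      have hj' := Finset.mem_range.1 hj
      have hxj := hx j
      rw [coeff_mul_X_pow', if_pos (by omega)]
      apply coeff_eq_zero_of_natDegree_lt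
      obtain rfl | hjN := eq_or_ne j N <;> omega
    · exact fun h => absurd (Finset.mem_range.2 (by omega)) h

theorem natDegree_Rpoly_isUnit_leadingCoeff {n : ℕ} (hn : n ≠ 0) :
    (Rpoly n).natDegree = 2 * 3 ^ n - 1 ∧ IsUnit (Rpoly n).leadingCoeff := by
  obtain ⟨hy, hlead⟩ := iterImagePoly_X_sub_C_natDegree_leadingCoeff (X : ℤ[X]) n
  have hpow : 3 ≤ 3 ^ n := Nat.le_self_pow hn 3
  have hconst : ((iterImagePoly (X - C X : ℤ[X][X]) n).coeff (3 ^ n)).natDegree = 0 := by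
    rw [← hy, coeff_natDegree, hlead, ← C_1, ← C_neg, ← C_pow, natDegree_C]
  obtain ⟨hle, hcoeff⟩ := natDegree_coeff_eval_X hy.le
    (fun j => (coeff_iterImagePoly_X_sub_C_X n j).1) (by omega)
  obtain ⟨hdeg, hunit⟩ :=
    iterImagePoly_C_natDegree_leadingCoeff (isUnit_one.neg : IsUnit (-1 : ℤ)) n
  rw [← Rpoly_eq_eval_iterImagePoly] at hle hcoeff
  rw [(coeff_iterImagePoly_X_sub_C_X n _).2, ← hdeg, ← C_1, ← C_neg, coeff_natDegree] at hcoeff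
  have hRdeg := natDegree_eq_of_le_of_coeff_ne_zero hle (hcoeff ▸ hunit.ne_zero)
  rw [leadingCoeff, hRdeg, hcoeff]
  exact ⟨rfl, hunit⟩

end Degree

theorem natDegree_Rpoly {n : ℕ} (hn : n ≠ 0) : (Rpoly n).natDegree = 2 * 3 ^ n - 1 :=
  (natDegree_Rpoly_isUnit_leadingCoeff hn).1

theorem isUnit_leadingCoeff_Rpoly {n : ℕ} (hn : n ≠ 0) : IsUnit (Rpoly n).leadingCoeff :=
  (natDegree_Rpoly_isUnit_leadingCoeff hn).2

theorem Rpoly_ne_zero {n : ℕ} (hn : n ≠ 0) : Rpoly n ≠ 0 :=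
  leadingCoeff_ne_zero.1 (isUnit_leadingCoeff_Rpoly hn).ne_zero

section CharThree

theorem fPoly_of_charP_three {A : Type*} [CommRing A] [CharP A 3] (a b : A) :
    fPoly a b = (a ^ 3 - b) * (b - 1) ^ 2 := by
  have h3 : (3 : A) = 0 := CharP.cast_eq_zero A 3
  rw [fPoly]
  linear_combination (a ^ 3 * b - b) * h3

theorem imagePoly_X_sub_C_mul_X_sub_one_pow {A : Type*} [CommRing A] [CharP A 3] (a : A) (k : ℕ) :
    imagePoly (k + 1) ((X - C a) * (X - 1) ^ k) =
      C ((-1) ^ (k + 1)) * ((X - C (a ^ 3)) * (X - 1) ^ (3 * k + 2)) := by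
  have : Nontrivial A := CharP.nontrivial_of_char_ne_one (R := A) (v := 3) (by norm_num)
  have hfactor (s : A) : fPoly (C s) X = -((X - C (s ^ 3)) * (X - 1) ^ 2) := by
    rw [fPoly_of_charP_three, C_pow]
    ring
  have h := imagePoly_prod_X_sub_C (a ::ₘ Multiset.replicate k (1 : A))
  simp only [Multiset.card_cons, Multiset.card_replicate, Multiset.map_cons, Multiset.map_replicate,
    Multiset.prod_cons, Multiset.prod_replicate, hfactor, one_pow, C_1] at h
  have hcube : -((X - 1) * (X - 1) ^ 2) = (-1 : A[X]) * (X - 1) ^ 3 := by ring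
  rw [h, hcube, mul_pow, ← pow_mul, C_pow (a := (-1 : A)), C_neg, C_1]
  ring

theorem iterImagePoly_of_charP_three {A : Type*} [CommRing A] [CharP A 3] (a : A) (n : ℕ) :
    iterImagePoly (X - C a) n =
      C ((-1) ^ n) * ((X - C (a ^ 3 ^ n)) * (X - 1) ^ (3 ^ n - 1)) := by
  induction n with
  | zero => simp [iterImagePoly]
  | succ n ih =>
    have h1 : 1 ≤ 3 ^ n := Nat.one_le_pow _ _ (by norm_num)
    have h3 : Odd (3 ^ n) := Odd.pow (by decide)
    have himg := imagePoly_X_sub_C_mul_X_sub_one_pow (a ^ 3 ^ n) (3 ^ n - 1)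
    rw [Nat.sub_add_cancel h1, h3.neg_one_pow, ← pow_mul, ← pow_succ] at himg
    rw [iterImagePoly_succ, ih, imagePoly_C_mul, himg, ← mul_assoc, ← C_mul, ← pow_mul, mul_comm n,
      pow_mul, (by decide : Odd 3).neg_one_pow, ← pow_succ]
    congr 3
    rw [pow_succ]
    omega

theorem map_Rpoly_of_charP_three (A : Type*) [CommRing A] [CharP A 3] (n : ℕ) :
    (Rpoly n).map (Int.castRingHom A) =
      (-1) ^ n * ((X - X ^ 3 ^ n) * (X - 1) ^ (3 ^ n - 1)) := by
  rw [← coe_mapRingHom, map_Rpoly_eq_eval_iterImagePoly, iterImagePoly_of_charP_three]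
  simp

end CharThree

section Chain

/-- `FChain n a b` says that `b` is reached from `a` by `n` steps of the correspondence `fPoly`; the
roots of `Rpoly n` are the points `a` with `FChain n a a`. -/
def FChain {A : Type*} [CommRing A] : ℕ → A → A → Prop
  | 0, a, b => a = b
  | n + 1, a, b => ∃ t, FChain n a t ∧ fPoly t b = 0

theorem fChain_one {A : Type*} [CommRing A] {a b : A} (h : fPoly a b = 0) : FChain 1 a b :=
  ⟨a, rfl, h⟩

theorem FChain.trans {A : Type*} [CommRing A] {a b c : A} {m n : ℕ} (hab : FChain m a b)
    (hbc : FChain n b c) : FChain (m + n) a c := by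
  induction n generalizing c with
  | zero =>
    obtain rfl : b = c := hbc
    exact hab
  | succ n ih =>
    obtain ⟨t, hbt, htc⟩ := hbc
    exact ⟨t, ih hbt, htc⟩

theorem FChain.self_of_dvd {A : Type*} [CommRing A] {a : A} {m n : ℕ} (h : FChain m a a)
    (hmn : m ∣ n) : FChain n a a := by
  obtain ⟨k, rfl⟩ := hmn
  induction k with
  | zero => rfl
  | succ k ih => exact ih.trans h

theorem fChain_one_one {A : Type*} [CommRing A] (n : ℕ) : FChain n (1 : A) 1 :=
  (fChain_one (by rw [fPoly]; ring)).self_of_dvd (one_dvd n)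

theorem isRoot_imagePoly_iff {K : Type*} [Field K] [IsAlgClosed K] {F : K[X]} (h0 : F ≠ 0) {b : K} :
    (imagePoly F.natDegree F).IsRoot b ↔ ∃ t, F.IsRoot t ∧ fPoly t b = 0 := by
  have hfactor (t : K) : (fPoly (C t) X).eval b = fPoly t b := by
    simpa using map_fPoly (evalRingHom b) (C t) X
  rw [imagePoly_of_splits (IsAlgClosed.splits F), IsRoot.def, eval_mul, eval_C,
    mul_eq_zero_iff_left (pow_ne_zero 3 (leadingCoeff_ne_zero.2 h0)), eval_multiset_prod,
    Multiset.map_map, Multiset.prod_eq_zero_iff]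
  simp only [Multiset.mem_map, Function.comp_apply, hfactor, mem_roots h0]

theorem isRoot_iterImagePoly_iff {K : Type*} [Field K] [IsAlgClosed K] {a b : K} {n : ℕ} :
    (iterImagePoly (X - C a) n).IsRoot b ↔ FChain n a b := by
  induction n generalizing b with
  | zero => rw [iterImagePoly, root_X_sub_C, FChain]
  | succ n ih =>
    obtain ⟨hdeg, hlead⟩ := iterImagePoly_X_sub_C_natDegree_leadingCoeff a n
    have h0 : iterImagePoly (X - C a) n ≠ 0 :=
      leadingCoeff_ne_zero.1 (hlead ▸ pow_ne_zero n (neg_ne_zero.2 one_ne_zero))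
    rw [iterImagePoly_succ, ← hdeg, isRoot_imagePoly_iff h0, FChain]
    simp only [ih]

theorem aeval_Rpoly_eq_zero_iff {K : Type*} [Field K] [IsAlgClosed K] {a : K} {n : ℕ} :
    aeval a (Rpoly n) = 0 ↔ FChain n a a := by
  have h := map_Rpoly_eq_eval_iterImagePoly (aeval a : ℤ[X] →ₐ[ℤ] K).toRingHom n
  simp only [AlgHom.toRingHom_eq_coe, RingHom.coe_coe, aeval_X] at h
  rw [h, ← IsRoot.def, isRoot_iterImagePoly_iff]

end Chain

section Involution

theorem eq_one_of_fPoly_one_left {A : Type*} [CommRing A] [IsReduced A] {b : A}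
    (h : fPoly 1 b = 0) : b = 1 := by
  have hcube : (b - 1) ^ 3 = 0 := by
    rw [fPoly] at h
    linear_combination -h
  exact sub_eq_zero.1 (pow_eq_zero_iff three_ne_zero |>.1 hcube)

theorem fPoly_involution {A : Type*} [CommRing A] [IsDomain A] (h3 : (3 : A) ≠ 0) {a b a' b' : A}
    (ha : (a - 1) * (a' - 1) = 3) (hb : (b - 1) * (b' - 1) = 3) (h : fPoly a b = 0) :
    fPoly b' a' = 0 := by
  have ha' : (a - 1) * a' = a + 2 := by linear_combination ha
  have hb' : (b - 1) * b' = b + 2 := by linear_combination hb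
  have hscale : ((a - 1) * (b - 1)) ^ 3 * fPoly b' a' = 27 * fPoly a b := by
    calc ((a - 1) * (b - 1)) ^ 3 * fPoly b' a'
        = ((b - 1) * b') ^ 3 * ((a - 1) *
              (((a - 1) * a') ^ 2 + ((a - 1) * a') * (a - 1) + (a - 1) ^ 2)) -
            (b - 1) ^ 3 * (((a - 1) * a') *
              (((a - 1) * a') ^ 2 - 2 * ((a - 1) * a') * (a - 1) + 4 * (a - 1) ^ 2)) := by
          rw [fPoly]
          ring
      _ = 27 * fPoly a b := by
          rw [ha', hb', fPoly]
          ring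
  rw [h, mul_zero] at hscale
  exact (mul_eq_zero.1 hscale).resolve_left (pow_ne_zero 3 (mul_ne_zero
    (left_ne_zero_of_mul (ha ▸ h3)) (left_ne_zero_of_mul (hb ▸ h3))))

theorem FChain.involution {K : Type*} [Field K] (h3 : (3 : K) ≠ 0) {a b a' b' : K} {n : ℕ}
    (ha : (a - 1) * (a' - 1) = 3) (hb : (b - 1) * (b' - 1) = 3) (h : FChain n a b) :
    FChain n b' a' := by
  induction n generalizing b b' with
  | zero =>
    obtain rfl : a = b := h
    exact sub_left_injective (mul_left_cancel₀ (left_ne_zero_of_mul (ha ▸ h3)) (hb.trans ha.symm))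
  | succ n ih =>
    obtain ⟨t, hat, htb⟩ := h
    have ht : t - 1 ≠ 0 := by
      intro ht
      rw [sub_eq_zero.1 ht] at htb
      rw [eq_one_of_fPoly_one_left htb, sub_self, zero_mul] at hb
      exact h3 hb.symm
    have htt : (t - 1) * ((3 / (t - 1) + 1) - 1) = 3 := by field_simp; ring
    rw [add_comm]
    exact (fChain_one (fPoly_involution h3 htt hb htb)).trans (ih htt hat)

end Involution

section RootsInDomain

variable {A : Type*} [CommRing A]

theorem aeval_Rpoly_eq_zero_iff_of_injective {K : Type*} [Field K] [IsAlgClosed K] {φ : A →+* K}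
    (hφ : Function.Injective φ) {a : A} {n : ℕ} :
    aeval a (Rpoly n) = 0 ↔ FChain n (φ a) (φ a) := by
  rw [← aeval_Rpoly_eq_zero_iff, ← map_eq_zero_iff φ hφ]
  exact Eq.congr_left (aeval_algHom_apply φ.toIntAlgHom a (Rpoly n)).symm

variable [IsDomain A]

theorem aeval_one_Rpoly (n : ℕ) : aeval (1 : A) (Rpoly n) = 0 := by
  obtain ⟨K, _, _, φ, hφ⟩ := exists_injective_ringHom_isAlgClosed A
  rw [aeval_Rpoly_eq_zero_iff_of_injective hφ, map_one]
  exact fChain_one_one n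

theorem aeval_Rpoly_of_dvd {a : A} {m n : ℕ} (h : aeval a (Rpoly m) = 0) (hmn : m ∣ n) :
    aeval a (Rpoly n) = 0 := by
  obtain ⟨K, _, _, φ, hφ⟩ := exists_injective_ringHom_isAlgClosed A
  rw [aeval_Rpoly_eq_zero_iff_of_injective hφ] at h ⊢
  exact h.self_of_dvd hmn

theorem aeval_Rpoly_involution (h3 : (3 : A) ≠ 0) {a a' : A} (ha : (a - 1) * (a' - 1) = 3) {n : ℕ}
    (h : aeval a (Rpoly n) = 0) : aeval a' (Rpoly n) = 0 := by
  obtain ⟨K, _, _, φ, hφ⟩ := exists_injective_ringHom_isAlgClosed A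
  have haK : (φ a - 1) * (φ a' - 1) = 3 := by
    simpa only [map_mul, map_sub, map_one, map_ofNat] using congrArg φ ha
  have h3K : (3 : K) ≠ 0 := map_ofNat φ 3 ▸ (map_ne_zero_iff φ hφ).2 h3
  rw [aeval_Rpoly_eq_zero_iff_of_injective hφ] at h ⊢
  exact h.involution h3K haK haK

end RootsInDomain

section Residue

theorem nodup_and_toFinset_eq_of_card_le {α : Type*} [DecidableEq α] {S : Finset α} {T : Multiset α}
    (hS : S ⊆ T.toFinset) (hT : T.card ≤ S.card) : T.Nodup ∧ T.toFinset = S := by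
  have hnodup := T.toFinset_card_le.antisymm (hT.trans (Finset.card_le_card hS))
  exact ⟨Multiset.toFinset_card_eq_card_iff_nodup.1 hnodup,
    (Finset.eq_of_subset_of_card_le hS (T.toFinset_card_le.trans hT)).symm⟩

variable {D κ : Type*} [CommRing D] [Field κ] [CharP κ 3] (π : D →+* κ)

theorem residue_eq_one_of_involution {u v : D} (h : (u - 1) * (v - 1) = 3) (hu1 : π u ≠ 1) :
    π v = 1 := by
  have hprod : (π u - 1) * (π v - 1) = 0 := by
    rw [← map_one π, ← map_sub, ← map_sub, ← map_mul, h, map_ofNat]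
    exact_mod_cast CharP.cast_eq_zero κ 3
  exact sub_eq_zero.1 ((mul_eq_zero.1 hprod).resolve_left (sub_ne_zero.2 hu1))

theorem residue_pow_eq_self_of_aeval_Rpoly {n : ℕ} {u : D} (hu : aeval u (Rpoly n) = 0)
    (hu1 : π u ≠ 1) : π u ^ 3 ^ n = π u := by
  have hred : ((Rpoly n).map (Int.castRingHom κ)).eval (π u) = 0 := by
    have hmap : aeval (π u) (Rpoly n) = π (aeval u (Rpoly n)) :=
      aeval_algHom_apply π.toIntAlgHom u _
    rwa [hu, map_zero, aeval_def, ← eval_map] at hmap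
  rw [map_Rpoly_of_charP_three] at hred
  simp only [eval_mul, eval_pow, eval_neg, eval_one, eval_sub, eval_X, mul_eq_zero,
    pow_eq_zero_iff', neg_eq_zero, one_ne_zero, false_and, false_or, sub_eq_zero, hu1, or_false]
    at hred
  exact hred.symm

variable [IsDomain D]

theorem map_aroots_Rpoly {n : ℕ} (hn : n ≠ 0) (hsplit : ((Rpoly n).map (algebraMap ℤ D)).Splits) :
    ((Rpoly n).aroots D).map π =
      (X ^ 3 ^ n - X : κ[X]).roots + Multiset.replicate (3 ^ n - 1) 1 := by
  have hmap : ((Rpoly n).map (algebraMap ℤ D)).map π =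
      C (-(-1) ^ n) * ((X ^ 3 ^ n - X) * (X - C 1) ^ (3 ^ n - 1)) := by
    rw [Polynomial.map_map, RingHom.ext_int (π.comp (algebraMap ℤ D)) (Int.castRingHom κ),
      map_Rpoly_of_charP_three, C_neg, C_pow, C_neg, C_1]
    ring
  have hsep : (X ^ 3 ^ n - X : κ[X]).Separable := galois_poly_separable 3 _ (dvd_pow_self 3 hn)
  have hne : (X ^ 3 ^ n - X : κ[X]) * (X - C 1) ^ (3 ^ n - 1) ≠ 0 :=
    mul_ne_zero hsep.ne_zero (pow_ne_zero _ (X_sub_C_ne_zero 1))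
  have hsign : -(-1 : κ) ^ n ≠ 0 := neg_ne_zero.2 (pow_ne_zero n (neg_ne_zero.2 one_ne_zero))
  rw [aroots, ← hsplit.roots_map_of_ne_zero (hmap ▸ mul_ne_zero (C_ne_zero.2 hsign) hne), hmap,
    roots_C_mul _ hsign, roots_mul hne, roots_pow, roots_X_sub_C, Multiset.nsmul_singleton]

open Classical in
theorem map_filter_aroots_Rpoly {n : ℕ} (hn : n ≠ 0)
    (hsplit : ((Rpoly n).map (algebraMap ℤ D)).Splits) :
    (((Rpoly n).aroots D).filter fun u => π u ≠ 1).map π =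
      (X ^ 3 ^ n - X : κ[X]).roots.erase 1 := by
  have hnodup : (X ^ 3 ^ n - X : κ[X]).roots.Nodup :=
    nodup_roots (galois_poly_separable 3 _ (dvd_pow_self 3 hn))
  have hreplicate : (Multiset.replicate (3 ^ n - 1) (1 : κ)).filter (· ≠ 1) = 0 :=
    Multiset.filter_eq_nil.2 fun _ hx => not_not.2 (Multiset.eq_of_mem_replicate hx)
  have hfilter := Multiset.filter_map (· ≠ 1) π ((Rpoly n).aroots D)
  rw [map_aroots_Rpoly π hn hsplit, Multiset.filter_add, hreplicate, add_zero,
    ← hnodup.erase_eq_filter] at hfilter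
  exact hfilter.symm

open Classical in
theorem nodup_map_filter_aroots_Rpoly {n : ℕ} (hn : n ≠ 0)
    (hsplit : ((Rpoly n).map (algebraMap ℤ D)).Splits) :
    ((((Rpoly n).aroots D).filter fun u => π u ≠ 1).map π).Nodup := by
  rw [map_filter_aroots_Rpoly π hn hsplit]
  exact (nodup_roots (galois_poly_separable 3 _ (dvd_pow_self 3 hn))).erase 1

variable [CharZero D]

theorem mem_aroots_Rpoly {n : ℕ} (hn : n ≠ 0) {u : D} :
    u ∈ (Rpoly n).aroots D ↔ aeval u (Rpoly n) = 0 := by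
  rw [mem_aroots, and_iff_right (Rpoly_ne_zero hn)]

theorem card_aroots_Rpoly {n : ℕ} (hn : n ≠ 0) (hsplit : ((Rpoly n).map (algebraMap ℤ D)).Splits) :
    ((Rpoly n).aroots D).card = 2 * 3 ^ n - 1 := by
  rw [aroots, ← hsplit.natDegree_eq_card_roots,
    natDegree_map_eq_of_injective (RingHom.injective_int _), natDegree_Rpoly hn]

theorem exists_aroots_Rpoly_involution {n : ℕ} (hn : n ≠ 0)
    (hsplit : ((Rpoly n).map (algebraMap ℤ D)).Splits) {u : D} (hu : aeval u (Rpoly n) = 0)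
    (hu1 : u ≠ 1) : ∃ v, aeval v (Rpoly n) = 0 ∧ (u - 1) * (v - 1) = 3 := by
  obtain ⟨K, _, _, φ, hφ⟩ := exists_injective_ringHom_isAlgClosed D
  have hu1K : φ u - 1 ≠ 0 := by
    rw [← map_one φ, ← map_sub]
    exact (map_ne_zero_iff φ hφ).2 (sub_ne_zero.2 hu1)
  have : CharZero K := charZero_of_injective_ringHom hφ
  have haeval (p : ℤ[X]) (v : D) : aeval (φ v) p = φ (aeval v p) :=
    aeval_algHom_apply φ.toIntAlgHom v p
  have hinv : (φ u - 1) * ((3 / (φ u - 1) + 1) - 1) = 3 := by field_simp; ring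
  have hroot := aeval_Rpoly_involution three_ne_zero hinv (n := n) (by rw [haeval, hu, map_zero])
  have hroots : (Rpoly n).aroots K = ((Rpoly n).aroots D).map φ := by
    rw [aroots, aroots, ← hsplit.roots_map_of_injective hφ, Polynomial.map_map]
    congr 2
    exact RingHom.ext_int _ _
  rw [← mem_aroots_Rpoly hn, hroots, Multiset.mem_map] at hroot
  obtain ⟨v, hv, hvK⟩ := hroot
  refine ⟨v, (mem_aroots_Rpoly hn).1 hv, hφ ?_⟩
  rw [map_mul, map_sub, map_sub, map_one, hvK, hinv, map_ofNat]

open Classical in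
theorem card_filter_aroots_Rpoly {n : ℕ} (hn : n ≠ 0)
    (hsplit : ((Rpoly n).map (algebraMap ℤ D)).Splits) :
    (((Rpoly n).aroots D).filter fun u => π u ≠ 1).card = 3 ^ n - 1 := by
  have hne : (X ^ 3 ^ n - X : κ[X]) ≠ 0 :=
    (galois_poly_separable 3 _ (dvd_pow_self 3 hn)).ne_zero
  have hcard := congrArg Multiset.card (map_aroots_Rpoly π hn hsplit)
  rw [Multiset.card_map, card_aroots_Rpoly hn hsplit, Multiset.card_add, Multiset.card_replicate]
    at hcard
  rw [← Multiset.card_map π, map_filter_aroots_Rpoly π hn hsplit, Multiset.card_erase_of_mem,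
    Nat.pred_eq_sub_one]
  · omega
  · rw [mem_roots hne]
    simp

theorem eq_of_aroots_Rpoly_of_residue_eq {n : ℕ} (hn : n ≠ 0)
    (hsplit : ((Rpoly n).map (algebraMap ℤ D)).Splits) {u v : D} (hu : aeval u (Rpoly n) = 0)
    (hv : aeval v (Rpoly n) = 0) (huv : π u = π v) (hu1 : π u ≠ 1) : u = v := by
  classical
  refine Multiset.inj_on_of_nodup_map (nodup_map_filter_aroots_Rpoly π hn hsplit) u ?_ v ?_ huv
  · exact Multiset.mem_filter.2 ⟨(mem_aroots_Rpoly hn).2 hu, hu1⟩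
  · exact Multiset.mem_filter.2 ⟨(mem_aroots_Rpoly hn).2 hv, huv ▸ hu1⟩

theorem card_insert_one_union_image_involution [DecidableEq D] {B : Finset D} {σ : D → D}
    (hB : ∀ u ∈ B, π u ≠ 1) (hσ : ∀ u ∈ B, (u - 1) * (σ u - 1) = 3) :
    (insert 1 (B ∪ B.image σ)).card = 2 * B.card + 1 := by
  have h3 : (3 : D) ≠ 0 := OfNat.ofNat_ne_zero 3
  have hσπ (u : D) (hu : u ∈ B) : π (σ u) = 1 :=
    residue_eq_one_of_involution π (hσ u hu) (hB u hu)
  have hinj : Set.InjOn σ B := by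
    intro u hu v hv huv
    have heq : (u - 1) * (σ u - 1) = (v - 1) * (σ u - 1) := by rw [hσ u hu, huv, hσ v hv]
    exact sub_left_injective (mul_right_cancel₀ (right_ne_zero_of_mul ((hσ u hu).trans_ne h3)) heq)
  have hdisj : Disjoint B (B.image σ) := by
    rw [Finset.disjoint_right, Finset.forall_mem_image]
    exact fun u hu hσu => hB _ hσu (hσπ u hu)
  have hone : (1 : D) ∉ B ∪ B.image σ := by
    rw [Finset.mem_union, not_or]
    refine ⟨fun h => hB 1 h (map_one π), fun h => ?_⟩
    obtain ⟨u, hu, hσu⟩ := Finset.mem_image.1 h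
    have hzero := hσ u hu
    rw [hσu, sub_self, mul_zero] at hzero
    exact h3 hzero.symm
  rw [Finset.card_insert_of_notMem hone, Finset.card_union_of_disjoint hdisj,
    Finset.card_image_of_injOn hinj]
  ring

-- Reduction modulo `3` accounts for `3 ^ n - 1` simple roots with residue different from `1`; their
-- images under the involution and the root `1` make up the remaining `3 ^ n`.
theorem nodup_aroots_Rpoly_and_residue {n : ℕ} (hn : n ≠ 0)
    (hsplit : ((Rpoly n).map (algebraMap ℤ D)).Splits) :
    ((Rpoly n).aroots D).Nodup ∧ ∀ u : D, aeval u (Rpoly n) = 0 →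
      u = 1 ∨ π u ≠ 1 ∨ ∃ v, aeval v (Rpoly n) = 0 ∧ π v ≠ 1 ∧ (v - 1) * (u - 1) = 3 := by
  classical
  let B := (((Rpoly n).aroots D).filter fun u => π u ≠ 1).toFinset
  have hB (u : D) : u ∈ B ↔ aeval u (Rpoly n) = 0 ∧ π u ≠ 1 := by
    simp only [B, Multiset.mem_toFinset, Multiset.mem_filter, mem_aroots_Rpoly hn]
  have hBcard : B.card = 3 ^ n - 1 := by
    rw [Multiset.toFinset_card_of_nodup (nodup_map_filter_aroots_Rpoly π hn hsplit).of_map,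
      card_filter_aroots_Rpoly π hn hsplit]
  have hinv (u : D) (hu : u ∈ B) : ∃ v, aeval v (Rpoly n) = 0 ∧ (u - 1) * (v - 1) = 3 :=
    exists_aroots_Rpoly_involution hn hsplit ((hB u).1 hu).1
      fun h => ((hB u).1 hu).2 (h ▸ map_one π)
  choose! σ hσroot hσ using hinv
  have hsub : insert 1 (B ∪ B.image σ) ⊆ ((Rpoly n).aroots D).toFinset := by
    intro u hu
    rw [Multiset.mem_toFinset, mem_aroots_Rpoly hn]
    rw [Finset.mem_insert, Finset.mem_union, Finset.mem_image] at hu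
    rcases hu with rfl | hu | ⟨v, hv, rfl⟩
    exacts [aeval_one_Rpoly n, ((hB u).1 hu).1, hσroot v hv]
  have hcard := card_insert_one_union_image_involution π (fun u hu => ((hB u).1 hu).2) hσ
  obtain ⟨hnodup, heq⟩ := nodup_and_toFinset_eq_of_card_le hsub (by
    rw [card_aroots_Rpoly hn hsplit, hcard, hBcard]
    omega)
  refine ⟨hnodup, fun u hu => ?_⟩
  rw [← mem_aroots_Rpoly hn, ← Multiset.mem_toFinset, heq, Finset.mem_insert, Finset.mem_union,
    Finset.mem_image] at hu
  rcases hu with rfl | hu | ⟨v, hv, rfl⟩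
  exacts [Or.inl rfl, Or.inr (Or.inl ((hB u).1 hu).2),
    Or.inr (Or.inr ⟨v, ((hB v).1 hv).1, ((hB v).1 hv).2, hσ v hv⟩)]

theorem exists_aroots_Rpoly_residue_eq {n : ℕ} (hn : n ≠ 0)
    (hsplit : ((Rpoly n).map (algebraMap ℤ D)).Splits) {b : κ} (hb : b ^ 3 ^ n = b) :
    ∃ v : D, aeval v (Rpoly n) = 0 ∧ π v = b := by
  have hne : (X ^ 3 ^ n - X : κ[X]) ≠ 0 :=
    (galois_poly_separable 3 _ (dvd_pow_self 3 hn)).ne_zero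
  have hmem : b ∈ ((Rpoly n).aroots D).map π := by
    rw [map_aroots_Rpoly π hn hsplit, Multiset.mem_add, mem_roots hne]
    exact Or.inl (by rw [IsRoot.def, eval_sub, eval_pow, eval_X, hb, sub_self])
  obtain ⟨v, hv, hvb⟩ := Multiset.mem_map.1 hmem
  exact ⟨v, (mem_aroots_Rpoly hn).1 hv, hvb⟩

variable (hsplit : ∀ n, ((Rpoly n).map (algebraMap ℤ D)).Splits)

include π hsplit

theorem aeval_Rpoly_iff_residue_pow_eq_self {m : ℕ} (hm : m ≠ 0) {u : D}
    (hu : aeval u (Rpoly m) = 0) (hu1 : π u ≠ 1) (n : ℕ) :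
    aeval u (Rpoly n) = 0 ↔ π u ^ 3 ^ n = π u := by
  refine ⟨fun hun => residue_pow_eq_self_of_aeval_Rpoly π hun hu1, fun hpow => ?_⟩
  rcases eq_or_ne n 0 with rfl | hn
  · simp [Rpoly, iterRes]
  obtain ⟨v, hv, hvu⟩ := exists_aroots_Rpoly_residue_eq π hn (hsplit n) hpow
  have heq := eq_of_aroots_Rpoly_of_residue_eq π (mul_ne_zero hm hn) (hsplit _)
    (aeval_Rpoly_of_dvd hu (dvd_mul_right m n)) (aeval_Rpoly_of_dvd hv (dvd_mul_left n m))
    hvu.symm hu1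
  rwa [heq]

theorem exists_forall_aeval_Rpoly_iff_dvd_of_residue_ne_one {m : ℕ} (hm : m ≠ 0) {u : D}
    (hu : aeval u (Rpoly m) = 0) (hu1 : π u ≠ 1) :
    ∃ d, ∀ n, aeval u (Rpoly n) = 0 ↔ d ∣ n := by
  have hroot (n : ℕ) : aeval u (Rpoly n) = 0 ↔ Function.minimalPeriod (· ^ 3) (π u) ∣ n := by
    rw [aeval_Rpoly_iff_residue_pow_eq_self π hsplit hm hu hu1,
      ← Function.isPeriodicPt_iff_minimalPeriod_dvd, Function.IsPeriodicPt, Function.IsFixedPt,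
      pow_iterate]
  exact ⟨_, hroot⟩

theorem exists_forall_aeval_Rpoly_iff_dvd_of_splits {m : ℕ} (hm : m ≠ 0) {u : D}
    (hu : aeval u (Rpoly m) = 0) : ∃ d, ∀ n, aeval u (Rpoly n) = 0 ↔ d ∣ n := by
  rcases (nodup_aroots_Rpoly_and_residue π hm (hsplit m)).2 u hu with rfl | hu1 | ⟨v, hv, hv1, h⟩
  · exact ⟨1, fun n => iff_of_true (aeval_one_Rpoly n) (one_dvd n)⟩
  · exact exists_forall_aeval_Rpoly_iff_dvd_of_residue_ne_one π hsplit hm hu hu1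
  · obtain ⟨d, hroot⟩ :=
      exists_forall_aeval_Rpoly_iff_dvd_of_residue_ne_one π hsplit hm hv hv1
    refine ⟨d, fun n => Iff.trans ⟨fun hn => ?_, fun hn => ?_⟩ (hroot n)⟩
    · exact aeval_Rpoly_involution (OfNat.ofNat_ne_zero 3) ((mul_comm _ _).trans h) hn
    · exact aeval_Rpoly_involution (OfNat.ofNat_ne_zero 3) h hn

end Residue

section AlgebraicIntegers

theorem isIntegral_of_isUnit_leadingCoeff {R A : Type*} [CommRing R] [CommRing A] [Algebra R A]
    {p : R[X]} (hp : IsUnit p.leadingCoeff) {a : A} (ha : aeval a p = 0) : IsIntegral R a := by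
  refine ⟨_, monic_of_isUnit_leadingCoeff_inv_smul hp, ?_⟩
  rw [← aeval_def, Units.smul_def, map_smul, ha, smul_zero]

theorem splits_map_integralClosure {R K : Type*} [CommRing R] [Field K] [IsAlgClosed K]
    [Algebra R K] {p : R[X]} (hp : IsUnit p.leadingCoeff) :
    (p.map (algebraMap R (integralClosure R K))).Splits := by
  have hmap : (p.map (algebraMap R (integralClosure R K))).map
      (algebraMap (integralClosure R K) K) = p.map (algebraMap R K) := by
    rw [Polynomial.map_map, ← IsScalarTower.algebraMap_eq]
  refine Splits.of_splits_map_of_injective (i := algebraMap (integralClosure R K) K)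
    Subtype.val_injective (IsAlgClosed.splits _) fun a ha => ?_
  rw [hmap, ← aroots_def] at ha
  exact ⟨⟨a, isIntegral_of_isUnit_leadingCoeff hp (mem_aroots'.1 ha).2⟩, rfl⟩

theorem exists_residue_field_of_isIntegral {A : Type*} [CommRing A] [CharZero A]
    [Algebra.IsIntegral ℤ A] (p : ℕ) [hp : Fact p.Prime] :
    ∃ M : Ideal A, M.IsMaximal ∧ CharP (A ⧸ M) p := by
  have hpZ : (Ideal.span {(p : ℤ)}).IsMaximal :=
    Int.ideal_span_isMaximal_of_prime p
  obtain ⟨M, hM, hlies⟩ :=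
    Ideal.exists_maximal_ideal_liesOver_of_isIntegral (S := A) (Ideal.span {(p : ℤ)})
  have hpM : ((p : ℕ) : A ⧸ M) = 0 := by
    have hmem := (Ideal.mem_of_liesOver M (Ideal.span {(p : ℤ)}) p).1
      (Ideal.mem_span_singleton_self _)
    simpa using Ideal.Quotient.eq_zero_iff_mem.2 hmem
  have := Ideal.Quotient.nontrivial_iff.2 hM.ne_top
  exact ⟨M, hM, (CharP.charP_iff_prime_eq_zero hp.out).2 hpM⟩

theorem nodup_aroots_Rpoly {n : ℕ} (hn : n ≠ 0) : ((Rpoly n).aroots ℂ).Nodup := by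
  have hsplit := splits_map_integralClosure (K := ℂ) (isUnit_leadingCoeff_Rpoly hn)
  obtain ⟨M, hM, _⟩ := exists_residue_field_of_isIntegral (A := integralClosure ℤ ℂ) 3
  let := Ideal.Quotient.field M
  have hroots : (Rpoly n).aroots ℂ = ((Rpoly n).aroots (integralClosure ℤ ℂ)).map
      (algebraMap (integralClosure ℤ ℂ) ℂ) := by
    rw [aroots_def, aroots_def, ← hsplit.roots_map_of_injective Subtype.val_injective,
      Polynomial.map_map, ← IsScalarTower.algebraMap_eq]
  rw [hroots]
  exact (nodup_aroots_Rpoly_and_residue (Ideal.Quotient.mk M) hn hsplit).1.map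
    Subtype.val_injective

-- The period `0` stands for the points that are not a root of any `Rpoly n` with `n ≠ 0`.
theorem exists_forall_aeval_Rpoly_iff_dvd (a : ℂ) : ∃ d, ∀ n, aeval a (Rpoly n) = 0 ↔ d ∣ n := by
  by_cases hroot : ∃ m, m ≠ 0 ∧ aeval a (Rpoly m) = 0
  · obtain ⟨m, hm, ha⟩ := hroot
    have hsplit (n : ℕ) : ((Rpoly n).map (algebraMap ℤ (integralClosure ℤ ℂ))).Splits := by
      rcases eq_or_ne n 0 with rfl | hn
      · simp [Rpoly, iterRes]
      · exact splits_map_integralClosure (isUnit_leadingCoeff_Rpoly hn)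
    obtain ⟨M, hM, _⟩ := exists_residue_field_of_isIntegral (A := integralClosure ℤ ℂ) 3
    let := Ideal.Quotient.field M
    lift a to integralClosure ℤ ℂ using
      isIntegral_of_isUnit_leadingCoeff (isUnit_leadingCoeff_Rpoly hm) ha
    have haeval (n : ℕ) : aeval (a : ℂ) (Rpoly n) = 0 ↔ aeval a (Rpoly n) = 0 :=
      aeval_algebraMap_eq_zero_iff ℂ a (Rpoly n)
    simp only [haeval] at ha ⊢
    exact exists_forall_aeval_Rpoly_iff_dvd_of_splits (Ideal.Quotient.mk M) hsplit hm ha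
  · push Not at hroot
    refine ⟨0, fun n => ?_⟩
    rw [zero_dvd_iff]
    refine ⟨fun h => by_contra fun hn => hroot n hn h, ?_⟩
    rintro rfl
    simp [Rpoly, iterRes]

theorem exists_forall_count_aroots_Rpoly (a : ℂ) :
    ∃ d, ∀ n, n ≠ 0 → ((Rpoly n).aroots ℂ).count a = if d ∣ n then 1 else 0 := by
  obtain ⟨d, hd⟩ := exists_forall_aeval_Rpoly_iff_dvd a
  refine ⟨d, fun n hn => ?_⟩
  simp only [Multiset.count_eq_of_nodup (nodup_aroots_Rpoly hn), mem_aroots_Rpoly hn, hd]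

end AlgebraicIntegers

section FractionField

variable {ι R : Type*} [CommRing R] {s : Finset ι} {x : ι → R}

variable {K : Type*} [Field K] [Algebra R K] [IsFractionRing R K]

theorem algebraMap_eq_prod_zpow_iff (hx : ∀ i ∈ s, x i ≠ 0) (e : ι → ℤ) (y : R) :
    algebraMap R K y = ∏ i ∈ s, algebraMap R K (x i) ^ e i ↔
      y * ∏ i ∈ s, x i ^ (-e i).toNat = ∏ i ∈ s, x i ^ (e i).toNat := by
  have hinj := IsFractionRing.injective R K
  have hxK (i : ι) (hi : i ∈ s) : algebraMap R K (x i) ≠ 0 := (map_ne_zero_iff _ hinj).2 (hx i hi)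
  have hzpow : ∏ i ∈ s, algebraMap R K (x i) ^ e i =
      (∏ i ∈ s, algebraMap R K (x i) ^ (e i).toNat) /
        ∏ i ∈ s, algebraMap R K (x i) ^ (-e i).toNat := by
    rw [← Finset.prod_div_distrib]
    refine Finset.prod_congr rfl fun i hi => ?_
    rw [← zpow_natCast, ← zpow_natCast, ← zpow_sub₀ (hxK i hi), Int.toNat_sub_toNat_neg]
  rw [hzpow, eq_div_iff (Finset.prod_ne_zero_iff.2 fun i hi => pow_ne_zero _ (hxK i hi)),
    ← hinj.eq_iff]
  simp only [map_mul, map_prod, map_pow]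

variable [IsDomain R]

theorem map_prod_pow_of_map_mul {G : Type*} [AddCommGroup G] {v : R → G}
    (hv : ∀ a b, a ≠ 0 → b ≠ 0 → v (a * b) = v a + v b) (hx : ∀ i ∈ s, x i ≠ 0) (k : ι → ℕ) :
    v (∏ i ∈ s, x i ^ k i) = ∑ i ∈ s, k i • v (x i) := by
  have hone : v 1 = 0 := by simpa using hv 1 1 one_ne_zero one_ne_zero
  have hpow {a : R} (ha : a ≠ 0) (j : ℕ) : v (a ^ j) = j • v a := by
    induction j with
    | zero => rw [pow_zero, hone, zero_smul]
    | succ j ih => rw [pow_succ, hv _ _ (pow_ne_zero j ha) ha, ih, succ_nsmul]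
  classical
  induction s using Finset.induction_on with
  | empty => simpa using hone
  | insert i s hi ih =>
    rw [Finset.forall_mem_insert] at hx
    rw [Finset.prod_insert hi, Finset.sum_insert hi, hv _ _ (pow_ne_zero _ hx.1)
      (Finset.prod_ne_zero_iff.2 fun j hj => pow_ne_zero _ (hx.2 j hj)), hpow hx.1, ih hx.2]

theorem map_eq_sum_smul_of_algebraMap_eq_prod_zpow {G : Type*} [AddCommGroup G] {v : R → G}
    (hv : ∀ a b, a ≠ 0 → b ≠ 0 → v (a * b) = v a + v b) (hx : ∀ i ∈ s, x i ≠ 0) {e : ι → ℤ}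
    {y : R} (hy : algebraMap R K y = ∏ i ∈ s, algebraMap R K (x i) ^ e i) :
    v y = ∑ i ∈ s, e i • v (x i) := by
  rw [algebraMap_eq_prod_zpow_iff hx] at hy
  have hden : ∏ i ∈ s, x i ^ (-e i).toNat ≠ 0 :=
    Finset.prod_ne_zero_iff.2 fun i hi => pow_ne_zero _ (hx i hi)
  have hy0 : y ≠ 0 := left_ne_zero_of_mul
    (hy.trans_ne (Finset.prod_ne_zero_iff.2 fun i hi => pow_ne_zero _ (hx i hi)))
  have hsum := congrArg v hy
  rw [hv _ _ hy0 hden, map_prod_pow_of_map_mul hv hx, map_prod_pow_of_map_mul hv hx,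
    ← eq_sub_iff_add_eq, ← Finset.sum_sub_distrib] at hsum
  rw [hsum]
  refine Finset.sum_congr rfl fun i _ => ?_
  rw [← natCast_zsmul, ← natCast_zsmul, ← sub_smul, Int.toNat_sub_toNat_neg]

end FractionField

section Divisibility

variable {R L : Type*} [CommRing R] [IsDomain R] [Field L] [Algebra R L] [FaithfulSMul R L]

theorem count_aroots_mul [DecidableEq L] (a : L) (p q : R[X]) (hp : p ≠ 0) (hq : q ≠ 0) :
    (((p * q).aroots L).count a : ℤ) = (p.aroots L).count a + (q.aroots L).count a := by
  rw [aroots_mul (mul_ne_zero hp hq), Multiset.count_add, Nat.cast_add]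

theorem dvd_of_aroots_le_aroots [IsAlgClosed L] {p q : R[X]} (hp : IsUnit p.leadingCoeff)
    (hq : q ≠ 0) (h : p.aroots L ≤ q.aroots L) : p ∣ q := by
  have hinj := FaithfulSMul.algebraMap_injective R L
  have hp0 : p ≠ 0 := leadingCoeff_ne_zero.1 hp.ne_zero
  have hdvd : p.map (algebraMap R L) ∣ q.map (algebraMap R L) :=
    (IsAlgClosed.dvd_iff_roots_le_roots ((Polynomial.map_ne_zero_iff hinj).2 hp0)
      ((Polynomial.map_ne_zero_iff hinj).2 hq)).2 h
  have hmonic := monic_of_isUnit_leadingCoeff_inv_smul hp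
  have hassoc : Associated (hp.unit⁻¹ • p) p := by
    rw [Units.smul_def, smul_eq_C_mul]
    exact associated_unit_mul_left _ _ (hp.unit⁻¹.isUnit.map C)
  rw [← hassoc.dvd_iff_dvd_left, ← Polynomial.map_dvd_map _ hinj hmonic]
  exact (hassoc.map (mapRingHom (algebraMap R L))).dvd_iff_dvd_left.2 hdvd

theorem exists_algebraMap_eq_prod_zpow [IsAlgClosed L] [DecidableEq L] {ι K : Type*} [Field K]
    [Algebra R[X] K] [IsFractionRing R[X] K] {s : Finset ι} {p : ι → R[X]} {e : ι → ℤ}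
    (hp : ∀ i ∈ s, IsUnit (p i).leadingCoeff)
    (hcount : ∀ a : L, 0 ≤ ∑ i ∈ s, e i * ((p i).aroots L).count a) :
    ∃ P : R[X], algebraMap R[X] K P = ∏ i ∈ s, algebraMap R[X] K (p i) ^ e i := by
  have hp0 (i : ι) (hi : i ∈ s) : p i ≠ 0 := leadingCoeff_ne_zero.1 (hp i hi).ne_zero
  have hunit : IsUnit (∏ i ∈ s, p i ^ (-e i).toNat).leadingCoeff := by
    rw [leadingCoeff_prod]
    simp only [leadingCoeff_pow]
    exact IsUnit.prod_iff.2 fun i hi => (hp i hi).pow _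
  have hle : (∏ i ∈ s, p i ^ (-e i).toNat).aroots L ≤ (∏ i ∈ s, p i ^ (e i).toNat).aroots L := by
    rw [Multiset.le_iff_count]
    intro a
    zify
    have hprod := map_prod_pow_of_map_mul (v := fun p : R[X] => ((p.aroots L).count a : ℤ))
      (count_aroots_mul a) hp0
    rw [hprod, hprod, ← sub_nonneg, ← Finset.sum_sub_distrib]
    convert hcount a using 2 with i
    rw [← natCast_zsmul, ← natCast_zsmul, ← sub_smul, Int.toNat_sub_toNat_neg, smul_eq_mul]
  obtain ⟨P, hP⟩ := dvd_of_aroots_le_aroots hunit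
    (Finset.prod_ne_zero_iff.2 fun i hi => pow_ne_zero _ (hp0 i hi)) hle
  exact ⟨P, (algebraMap_eq_prod_zpow_iff hp0 e P).2 (by rw [hP, mul_comm])⟩

end Divisibility

section Moebius

theorem sum_divisors_moebius_div_mul_ite_dvd {n : ℕ} (hn : n ≠ 0) (d : ℕ) :
    ∑ k ∈ n.divisors, ArithmeticFunction.moebius (n / k) * (if d ∣ k then 1 else 0) =
      if n = d then 1 else 0 := by
  have hsum (m : ℕ) (hm : m > 0) :
      ∑ i ∈ m.divisors, (if i = d then 1 else 0 : ℤ) = if d ∣ m then 1 else 0 := by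
    simp only [Finset.sum_ite_eq', Nat.mem_divisors, hm.ne', ne_eq, not_false_eq_true, and_true]
  have hinv := ArithmeticFunction.sum_eq_iff_sum_mul_moebius_eq.1 hsum n hn.bot_lt
  simp only [Int.cast_id] at hinv
  rwa [Nat.sum_divisorsAntidiagonal' fun i j =>
    ArithmeticFunction.moebius i * (if d ∣ j then 1 else 0 : ℤ)] at hinv

variable {n : ℕ} {P : ℤ[X]}

theorem Rpoly_ne_zero_of_mem_divisors {k : ℕ} (hk : k ∈ n.divisors) : Rpoly k ≠ 0 :=
  Rpoly_ne_zero (Nat.pos_of_mem_divisors hk).ne'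

theorem natDegree_of_algebraMap_eq_Pfrac (hn : 2 ≤ n)
    (hP : algebraMap ℤ[X] (FractionRing ℤ[X]) P = Pfrac n) :
    (P.natDegree : ℤ) =
      2 * ∑ k ∈ n.divisors, ArithmeticFunction.moebius (n / k) * (3 : ℤ) ^ k := by
  have hdeg (k : ℕ) (hk : k ∈ n.divisors) : ((Rpoly k).natDegree : ℤ) = 2 * 3 ^ k - 1 := by
    rw [natDegree_Rpoly (Nat.pos_of_mem_divisors hk).ne',
      Nat.cast_sub (Nat.one_le_iff_ne_zero.2 (by positivity))]
    push_cast
    rfl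
  have hzero : ∑ k ∈ n.divisors, ArithmeticFunction.moebius (n / k) = 0 := by
    have hone := sum_divisors_moebius_div_mul_ite_dvd (n := n) (by omega) 1
    simpa only [one_dvd, if_true, mul_one, show n ≠ 1 by omega, if_false] using hone
  calc (P.natDegree : ℤ)
      = ∑ k ∈ n.divisors, ArithmeticFunction.moebius (n / k) • ((Rpoly k).natDegree : ℤ) :=
        map_eq_sum_smul_of_algebraMap_eq_prod_zpow (v := fun p : ℤ[X] => (p.natDegree : ℤ))
          (fun p q hp hq => by rw [natDegree_mul hp hq, Nat.cast_add])
          (fun k hk => Rpoly_ne_zero_of_mem_divisors hk) hP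
    _ = ∑ k ∈ n.divisors, (2 * (ArithmeticFunction.moebius (n / k) * 3 ^ k) -
          ArithmeticFunction.moebius (n / k)) :=
        Finset.sum_congr rfl fun k hk => by rw [hdeg k hk, smul_eq_mul]; ring
    _ = 2 * ∑ k ∈ n.divisors, ArithmeticFunction.moebius (n / k) * (3 : ℤ) ^ k := by
        rw [Finset.sum_sub_distrib, hzero, sub_zero, Finset.mul_sum]

theorem exists_sum_divisors_moebius_div_mul_count_aroots_Rpoly (hn : n ≠ 0) (a : ℂ) :
    ∃ d, ∑ k ∈ n.divisors, ArithmeticFunction.moebius (n / k) * ((Rpoly k).aroots ℂ).count a =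
      if n = d then 1 else 0 := by
  obtain ⟨d, hd⟩ := exists_forall_count_aroots_Rpoly a
  refine ⟨d, ?_⟩
  rw [← sum_divisors_moebius_div_mul_ite_dvd hn d]
  refine Finset.sum_congr rfl fun k hk => ?_
  rw [hd k (Nat.pos_of_mem_divisors hk).ne', Nat.cast_ite, Nat.cast_one, Nat.cast_zero]

theorem exists_algebraMap_eq_Pfrac (hn : n ≠ 0) :
    ∃ P : ℤ[X], algebraMap ℤ[X] (FractionRing ℤ[X]) P = Pfrac n := by
  refine exists_algebraMap_eq_prod_zpow (L := ℂ)
    (fun k hk => isUnit_leadingCoeff_Rpoly (Nat.pos_of_mem_divisors hk).ne') fun a => ?_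
  obtain ⟨d, hd⟩ := exists_sum_divisors_moebius_div_mul_count_aroots_Rpoly hn a
  rw [hd]
  split_ifs <;> norm_num

theorem hasDistinctRoots_of_algebraMap_eq_Pfrac (hn : n ≠ 0)
    (hP : algebraMap ℤ[X] (FractionRing ℤ[X]) P = Pfrac n) : HasDistinctRoots P := by
  have hinj := IsFractionRing.injective ℤ[X] (FractionRing ℤ[X])
  refine ⟨(map_ne_zero_iff _ hinj).1 (hP.trans_ne ?_),
    Multiset.nodup_iff_count_le_one.2 fun a => ?_⟩
  · exact Finset.prod_ne_zero_iff.2 fun k hk =>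
      zpow_ne_zero _ ((map_ne_zero_iff _ hinj).2 (Rpoly_ne_zero_of_mem_divisors hk))
  · obtain ⟨d, hd⟩ := exists_sum_divisors_moebius_div_mul_count_aroots_Rpoly hn a
    have hcount := map_eq_sum_smul_of_algebraMap_eq_prod_zpow
      (v := fun p : ℤ[X] => ((p.aroots ℂ).count a : ℤ)) (count_aroots_mul a)
      (fun k hk => Rpoly_ne_zero_of_mem_divisors hk) hP
    simp only [smul_eq_mul] at hcount
    zify
    rw [hcount, hd]
    split_ifs <;> norm_num

end Moebius

theorem proposition14 (n : ℕ) (hn : 1 ≤ n) :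
    HasDistinctRoots (Rpoly n) ∧
    (∃ P : ℤ[X], algebraMap ℤ[X] (FractionRing ℤ[X]) P = Pfrac n ∧
      HasDistinctRoots P ∧
      (2 ≤ n → (P.natDegree : ℤ) =
        2 * ∑ k ∈ n.divisors, ArithmeticFunction.moebius (n / k) * (3 : ℤ) ^ k)) ∧
    (Rpoly n).map (Int.castRingHom (ZMod 3)) =
      (-1) ^ (n - 1) * (X ^ 3 ^ n - X) * (X - 1) ^ (3 ^ n - 1) ∧
    (Rpoly n).natDegree = 2 * 3 ^ n - 1 := by
  have hn0 : n ≠ 0 := Nat.one_le_iff_ne_zero.1 hn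
  obtain ⟨P, hP⟩ := exists_algebraMap_eq_Pfrac hn0
  refine ⟨⟨Rpoly_ne_zero hn0, nodup_aroots_Rpoly hn0⟩,
    ⟨P, hP, hasDistinctRoots_of_algebraMap_eq_Pfrac hn0 hP,
      fun h2 => natDegree_of_algebraMap_eq_Pfrac h2 hP⟩, ?_, natDegree_Rpoly hn0⟩
  have hsign : (-1 : (ZMod 3)[X]) ^ n = -(-1) ^ (n - 1) := by
    rw [← Nat.sub_add_cancel hn, pow_succ, Nat.add_sub_cancel, mul_neg_one]
  rw [map_Rpoly_of_charP_three, hsign]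
  ring
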